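/- Let $G$ be a finite simple connected graph with adjacency matrix $A(G)$. For $\lambda\in\mathbb{R}$ let $m_\lambda(G)$ be the multiplicity of $\lambda$ as an eigenvalue of $A(G)$, let $\beta(G)$ be the matching number of $G$ (the maximum number of pairwise disjoint edges), and let $c(G)=|E(G)|-|V(G)|+\omega(G)$ be the cyclomatic number of $G$, where $\omega(G)$ is the number of connected components. Then, for every nonzero eigenvalue $\lambda$ of $A(G)$, $$m_\lambda(G)\le \beta(G)+c(G),$$ and equality holds if and only if either $G\cong C_3$ and $\lambda=-1$, or $G\cong K_{1,t}$ for some $t\ge 1$. In particular, equality holds for some nonzero eigenvalue $\lambda$ of $A(G)$ if and only if $G\cong C_3$ or $G\cong K_{1,t}$ for some $t\ge 1$. -/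

import Mathlib

namespace EigMatching

noncomputable section

/-- The multiplicity `m_λ(G)` of the real number `lam` as an eigenvalue of the adjacency matrix
of the finite graph `G`: the dimension of the eigenspace `{x : A(G) x = lam x}`
(the matrix is real symmetric, so this is also the algebraic multiplicity). -/
def eigMult {V : Type*} [Fintype V] [DecidableEq V] (G : SimpleGraph V) [DecidableRel G.Adj]
    (lam : ℝ) : ℕ :=
  Module.finrank ℝ (Module.End.eigenspace (Matrix.toLin' (G.adjMatrix ℝ)) lam)

/-- The matching number `β(G)`: the largest number of edges of a matching of `G`.
For a finite graph the set below is nonempty and bounded, so the supremum is attained. -/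
def matchingNumber {V : Type*} (G : SimpleGraph V) : ℕ :=
  sSup {k : ℕ | ∃ M : G.Subgraph, M.IsMatching ∧ M.edgeSet.ncard = k}

/-- The cyclomatic number `c(G) = |E(G)| - |V(G)| + ω(G)` of a finite graph, as an integer,
where `ω(G)` is the number of connected components. -/
def cyclomaticNumber {V : Type*} (G : SimpleGraph V) : ℤ :=
  (G.edgeSet.ncard : ℤ) - (Nat.card V : ℤ) + (Nat.card G.ConnectedComponent : ℤ)

/-- `G` is isomorphic to the cycle `C_3`. -/
def IsC3 {V : Type*} (G : SimpleGraph V) : Prop :=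
  Nonempty (G ≃g SimpleGraph.cycleGraph 3)

/-- `G` is isomorphic to a star `K_{1,t}` with `t ≥ 1`. -/
def IsStar {V : Type*} (G : SimpleGraph V) : Prop :=
  ∃ t : ℕ, 1 ≤ t ∧ Nonempty (G ≃g completeBipartiteGraph (Fin 1) (Fin t))

end

end EigMatching

/-!
For `lam ≠ 0` an eigenvector of the adjacency matrix is determined by its values on any vertex
cover `U`, because the eigenvalue equation at a vertex outside `U` involves only neighbours in `U`.
Hence `m_lam(G) ≤ #U` (`eigMult_le_card`). A connected graph has a vertex cover with at most
`β(G) + c(G)` vertices (`exists_isVertexCover_card_le`): a spanning tree has a cover of the size of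
one of its matchings, and the `c(G)` edges outside the tree need at most one further vertex each.

If equality holds for such a cover `U`, every vector on `U` extends to an eigenvector, which forces
`lam² = lam * A_U + B * Bᵀ` for the blocks `A_U` (inside `U`) and `B` (between `U` and its
complement) of the adjacency matrix (`card_common_of_eigMult_eq`). So two distinct vertices of `U`
are adjacent exactly when they have a common neighbour outside `U`. If `U` is one vertex, `G` is a
star. Otherwise every edge from a vertex of `U` to its parent in a breadth-first tree lies in a
triangle with third vertex outside `U`, and these triangles give `#U - 1` distinct edges outside
the tree (`card_le_cyclomaticNumber_add_one`). Hence `β(G) = 1`, so `G` is a triangle, and the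
off-diagonal entry of the matrix equation is `0 = lam + 1`.
-/

namespace EigMatching

open SimpleGraph Finset

/-! ### Matchings -/

section Matching

variable {V : Type*} [Finite V] {G : SimpleGraph V}

theorem bddAbove_matchingSizes (G : SimpleGraph V) :
    BddAbove {k : ℕ | ∃ M : G.Subgraph, M.IsMatching ∧ M.edgeSet.ncard = k} := by
  refine ⟨Nat.card (Sym2 V), ?_⟩
  rintro _ ⟨M, -, rfl⟩
  exact Set.ncard_le_card _

/-- A family of edges `f i — g i` whose endpoints are all distinct bounds the matching number
from below by the size of the family. -/
theorem card_le_matchingNumber {ι : Type*} [Fintype ι] (f g : ι → V)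
    (hadj : ∀ i, G.Adj (f i) (g i)) (hinj : Function.Injective (Sum.elim f g)) :
    Fintype.card ι ≤ matchingNumber G := by
  have hf : ∀ i j, f i = f j → i = j := fun i j h =>
    Sum.inl_injective (hinj (a₁ := .inl i) (a₂ := .inl j) h)
  have hg : ∀ i j, g i = g j → i = j := fun i j h =>
    Sum.inr_injective (hinj (a₁ := .inr i) (a₂ := .inr j) h)
  have hfg : ∀ i j, f i ≠ g j := fun i j h =>
    Sum.inl_ne_inr (hinj (a₁ := .inl i) (a₂ := .inr j) h)
  refine le_csSup (bddAbove_matchingSizes G)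
    ⟨⨆ i, G.subgraphOfAdj (hadj i), Subgraph.IsMatching.iSup
      (fun i => Subgraph.IsMatching.subgraphOfAdj _) ?_, ?_⟩
  · intro i j hij
    simp only [support_subgraphOfAdj]
    rw [Set.disjoint_left]
    rintro x (rfl | rfl) (h | h)
    · exact hij (hf _ _ h)
    · exact hfg _ _ h
    · exact hfg _ _ h.symm
    · exact hij (hg _ _ h)
  · have : (⨆ i, G.subgraphOfAdj (hadj i)).edgeSet = Set.range fun i => s(f i, g i) := by
      ext e
      simp [Subgraph.edgeSet_iSup, eq_comm]
    rw [this, ← Set.image_univ, Set.ncard_image_of_injective, Set.ncard_univ,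
      Nat.card_eq_fintype_card]
    intro i j h
    rcases Sym2.eq_iff.1 h with h | h
    · exact hf _ _ h.1
    · exact absurd h.1 (hfg _ _)

theorem one_le_matchingNumber {a b : V} (h : G.Adj a b) : 1 ≤ matchingNumber G := by
  refine card_le_matchingNumber (ι := Unit) (fun _ => a) (fun _ => b) (fun _ => h) ?_
  have := h.ne
  rintro (_ | _) (_ | _) <;> simp [this, this.symm]

theorem two_le_matchingNumber {a b c d : V} (hab : G.Adj a b) (hcd : G.Adj c d)
    (hac : a ≠ c) (had : a ≠ d) (hbc : b ≠ c) (hbd : b ≠ d) : 2 ≤ matchingNumber G := by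
  have h1 := hab.ne
  have h2 := hcd.ne
  refine card_le_matchingNumber (ι := Bool) (fun i => bif i then a else c)
    (fun i => bif i then b else d) (by rintro (_ | _) <;> assumption) ?_
  rintro ((_ | _) | (_ | _)) ((_ | _) | (_ | _)) <;>
    simp [hac, had, hbc, hbd, h1, h2, hac.symm, had.symm, hbc.symm, hbd.symm, h1.symm, h2.symm]

theorem matchingNumber_le_one
    (h : ∀ a b c d, G.Adj a b → G.Adj c d → a = c ∨ a = d ∨ b = c ∨ b = d) :
    matchingNumber G ≤ 1 := by
  refine csSup_le ⟨0, ⊥, by simp [Subgraph.IsMatching], by simp⟩ ?_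
  rintro _ ⟨M, hM, rfl⟩
  rw [Set.ncard_le_one]
  intro e he e' he'
  induction e with | _ a b
  induction e' with | _ c d
  rw [Subgraph.mem_edgeSet] at he he'
  rcases h a b c d he.adj_sub he'.adj_sub with rfl | rfl | rfl | rfl
  · rw [hM.eq_of_adj_left he he']
  · rw [hM.eq_of_adj_left he he'.symm, Sym2.eq_swap]
  · rw [hM.eq_of_adj_left he.symm he', Sym2.eq_swap]
  · rw [hM.eq_of_adj_left he.symm he'.symm]

/-- An edge leaving a triangle is disjoint from one of its sides, so a connected graph without
two disjoint edges that contains a triangle is that triangle. -/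
theorem eq_of_triangle (hG : G.Connected) (hβ : matchingNumber G ≤ 1) {a b c : V}
    (hab : G.Adj a b) (hbc : G.Adj b c) (hac : G.Adj a c) (v : V) :
    v = a ∨ v = b ∨ v = c := by
  obtain ⟨q⟩ := hG.preconnected v a
  induction q with
  | nil => exact .inl rfl
  | @cons v w _ h q ih =>
    by_contra! hv
    obtain ⟨hva, hvb, hvc⟩ := hv
    have := hab.ne
    have := hbc.ne
    have := hac.ne
    rcases ih hab hac with rfl | rfl | rfl
    · have := two_le_matchingNumber h hbc hvb hvc ‹_› ‹_›
      omega
    · have := two_le_matchingNumber h hac hva hvc (Ne.symm ‹_›) ‹_›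
      omega
    · have := two_le_matchingNumber h hab hva hvb (Ne.symm ‹_›) (Ne.symm ‹_›)
      omega

end Matching

/-! ### Breadth-first spanning trees -/

section Tree

variable {V : Type*} {G : SimpleGraph V}

theorem dist_le_dist_add_one (hG : G.Connected) {v w : V} (h : G.Adj v w) (r : V) :
    G.dist v r ≤ G.dist w r + 1 := by
  have := hG.dist_triangle (u := v) (v := w) (w := r)
  rw [dist_eq_one_iff_adj.2 h] at this
  omega

theorem card_connectedComponent_of_connected (hG : G.Connected) :
    Nat.card G.ConnectedComponent = 1 := by
  obtain ⟨r⟩ := hG.nonempty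
  have := hG.preconnected.subsingleton_connectedComponent
  have : Nonempty G.ConnectedComponent := ⟨G.connectedComponentMk r⟩
  exact Nat.card_eq_one_iff_unique.2 ⟨inferInstance, inferInstance⟩

/-- A breadth-first spanning tree with root `r`, given by its parent function. -/
theorem exists_parent (hG : G.Connected) (r : V) :
    ∃ p : V → V, ∀ v, v ≠ r → G.Adj v (p v) ∧ G.dist (p v) r < G.dist v r := by
  have : ∀ v, ∃ w, v ≠ r → G.Adj v w ∧ G.dist w r < G.dist v r := by
    intro v
    obtain ⟨q, hq⟩ := hG.exists_walk_length_eq_dist v r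
    cases q with
    | nil => exact ⟨r, fun h => absurd rfl h⟩
    | cons h q =>
      rename_i w
      refine ⟨w, fun _ => ⟨h, ?_⟩⟩
      have := dist_le q
      rw [Walk.length_cons] at hq
      omega
  exact ⟨fun v => (this v).choose, fun v => (this v).choose_spec⟩

/-- The edges `{v, p v}`, `v ≠ r`, of the tree with root `r` and parent function `p`. -/
def parentEdges (p : V → V) (r : V) : Set (Sym2 V) := (fun v => s(v, p v)) '' {r}ᶜ

/-- The cyclomatic number counts the edges outside a spanning tree. -/
theorem cyclomaticNumber_eq [Finite V] (hG : G.Connected) {p : V → V} {r : V}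
    (hp : ∀ v, v ≠ r → G.Adj v (p v) ∧ G.dist (p v) r < G.dist v r) :
    cyclomaticNumber G = (G.edgeSet \ parentEdges p r).ncard := by
  have hsub : parentEdges p r ⊆ G.edgeSet := by
    rintro _ ⟨v, hv, rfl⟩
    exact (hp v hv).1
  have hcard : (parentEdges p r).ncard + 1 = Nat.card V := by
    have h1 : (parentEdges p r).ncard = ({r}ᶜ : Set V).ncard := by
      refine Set.InjOn.ncard_image fun v hv w hw h => ?_
      rcases Sym2.eq_iff.1 h with h | ⟨h1, h2⟩
      · exact h.1
      · have := (hp v hv).2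
        have := (hp w hw).2
        rw [← h1] at this
        rw [h2] at *
        omega
    have h2 := Set.ncard_add_ncard_compl ({r} : Set V)
    rw [Set.ncard_singleton] at h2
    omega
  have hcomp := card_connectedComponent_of_connected hG
  have := Set.ncard_sdiff_add_ncard_of_subset hsub
  rw [cyclomaticNumber, hcomp]
  omega

/-- Kőnig's theorem for a rooted forest given by a parent function `p` decreasing the depth `d`:
the edges `{v, p v}`, `v ∈ S`, contain a matching, indexed by `A`, such that the upper ends of
the matching edges cover all edges.  The matching is found greedily, deepest edge first. -/
theorem exists_matching_cover [DecidableEq V] (p : V → V) (d : V → ℕ) (S : Finset V)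
    (hd : ∀ v ∈ S, d (p v) < d v) :
    ∃ A ⊆ S, (∀ a ∈ A, ∀ b ∈ A, a ≠ b → p a ≠ p b ∧ a ≠ p b) ∧
      ∀ v ∈ S, v ∈ A.image p ∨ p v ∈ A.image p := by
  induction S using Finset.strongInduction with
  | H S ih =>
    rcases S.eq_empty_or_nonempty with rfl | hS
    · exact ⟨∅, by simp⟩
    obtain ⟨v, hv, hmax⟩ := S.exists_max_image d hS
    set S' := S.filter fun w => w ≠ p v ∧ p w ≠ p v with hS'
    have hvS' : v ∉ S' := by simp [hS']
    have hsub : S' ⊆ S := filter_subset _ _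
    obtain ⟨A, hAS, hA, hcov⟩ := ih S' (hsub.ssubset_of_mem_notMem hv hvS')
      fun w hw => hd w (hsub hw)
    have hout : ∀ a ∈ A, a ≠ p v ∧ p a ≠ p v ∧ p a ≠ v := by
      intro a ha
      have h := hAS ha
      rw [hS', mem_filter] at h
      refine ⟨h.2.1, h.2.2, fun h' => ?_⟩
      have h1 := hd a h.1
      have h2 := hmax a h.1
      rw [h'] at h1
      omega
    refine ⟨insert v A, insert_subset hv (hAS.trans hsub), ?_, ?_⟩
    · have hvv : v ≠ p v := fun h => by
        have := hd v hv
        rw [← h] at this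
        omega
      intro a ha b hb hab
      rw [mem_insert] at ha hb
      rcases ha with rfl | ha <;> rcases hb with rfl | hb
      · exact absurd rfl hab
      · exact ⟨(hout b hb).2.1.symm, (hout b hb).2.2.symm⟩
      · exact ⟨(hout a ha).2.1, (hout a ha).1⟩
      · exact hA a ha b hb hab
    · intro w hw
      by_cases h : w ∈ S'
      · rcases hcov w h with h | h
        · exact .inl (image_subset_image (subset_insert _ _) h)
        · exact .inr (image_subset_image (subset_insert _ _) h)
      · have : w = p v ∨ p w = p v := by
          by_contra! h'
          exact h (mem_filter.2 ⟨hw, h'⟩)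
        rcases this with h | h
        · exact .inl (h ▸ mem_image_of_mem _ (mem_insert_self _ _))
        · exact .inr (h ▸ mem_image_of_mem _ (mem_insert_self _ _))

/-- A connected graph has a vertex cover of size at most `β(G) + c(G)`: take a minimum cover of a
spanning tree, together with one end of each of the `c(G)` remaining edges. -/
theorem exists_isVertexCover_card_le [Fintype V] (hG : G.Connected) :
    ∃ U : Finset V, G.IsVertexCover U ∧
      (#U : ℤ) ≤ matchingNumber G + cyclomaticNumber G := by
  classical
  obtain ⟨r⟩ := hG.nonempty
  obtain ⟨p, hp⟩ := exists_parent hG r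
  obtain ⟨A, hAS, hA, hcov⟩ := exists_matching_cover p (G.dist · r) (univ.erase r)
    fun v hv => (hp v (ne_of_mem_erase hv)).2
  have hAr : ∀ a ∈ A, a ≠ r := fun a ha => ne_of_mem_erase (hAS ha)
  set X := (G.edgeSet \ parentEdges p r).toFinite.toFinset with hX
  refine ⟨A.image p ∪ X.image fun e => e.out.1, ?_, ?_⟩
  · intro v w hvw
    simp only [coe_union, Set.mem_union, mem_coe]
    by_cases h : s(v, w) ∈ parentEdges p r
    · obtain ⟨x, hx, hxe⟩ := h
      have := hcov x (mem_erase.2 ⟨hx, mem_univ _⟩)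
      rcases Sym2.eq_iff.1 hxe with ⟨rfl, rfl⟩ | ⟨rfl, rfl⟩
      · tauto
      · tauto
    · have hmem : s(v, w).out.1 ∈ X.image fun e => e.out.1 :=
        mem_image_of_mem _ (by simpa [hX] using ⟨hvw, h⟩)
      rcases Sym2.mem_iff.1 (Sym2.out_fst_mem s(v, w)) with h | h <;> rw [h] at hmem <;> tauto
  · have h1 : #A ≤ matchingNumber G := by
      rw [← Fintype.card_coe]
      refine card_le_matchingNumber (fun a : A => a.1) (fun a => p a)
        (fun a => (hp a (hAr a a.2)).1) ?_
      have hself : ∀ a ∈ A, a ≠ p a := fun a ha => (hp a (hAr a ha)).1.ne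
      have hne : ∀ a ∈ A, ∀ b ∈ A, a ≠ p b := fun a ha b hb h => by
        by_cases hab : a = b
        · subst hab
          exact hself a ha h
        · exact (hA a ha b hb hab).2 h
      rintro (⟨a, ha⟩ | ⟨a, ha⟩) (⟨b, hb⟩ | ⟨b, hb⟩) h
      · simpa using h
      · exact absurd h (hne a ha b hb)
      · exact absurd h.symm (hne b hb a ha)
      · by_contra hab
        exact (hA a ha b hb (by simpa using hab)).1 h
    have h2 : #X = (G.edgeSet \ parentEdges p r).ncard :=
      (Set.ncard_eq_toFinset_card _).symm
    have h3 := card_union_le (A.image p) (X.image fun e => e.out.1)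
    have h4 : #(A.image p) ≤ #A := card_image_le
    have h5 : #(X.image fun e => e.out.1) ≤ #X := card_image_le
    rw [cyclomaticNumber_eq hG hp]
    omega

/-- If the parent of `u ∈ U` were outside the cover, `u` and its grandparent, which is in the cover,
would be adjacent, although their distances to the root differ by two. -/
theorem parent_mem_of_isVertexCover (hG : G.Connected) {U : Finset V}
    (hU : G.IsVertexCover U) {r : V} (hr : r ∈ U) {p : V → V}
    (hp : ∀ v, v ≠ r → G.Adj v (p v) ∧ G.dist (p v) r < G.dist v r)
    (hadj : ∀ u ∈ U, ∀ v ∈ U, u ≠ v → ∀ i ∉ U, G.Adj u i → G.Adj v i → G.Adj u v)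
    {u : V} (hu : u ∈ U) (hur : u ≠ r) : p u ∈ U := by
  by_contra hpu
  have hpr : p u ≠ r := fun h => hpu (h ▸ hr)
  obtain ⟨h1, h2⟩ := hp u hur
  obtain ⟨h3, h4⟩ := hp (p u) hpr
  have h5 : p (p u) ∈ U := (hU h3).resolve_left hpu
  have hne : u ≠ p (p u) := fun h => by
    rw [← h] at h4
    omega
  have := dist_le_dist_add_one hG (hadj u hu _ h5 hne _ hpu h1 h3.symm) r
  omega

/-- Suppose that any two vertices of a vertex cover `U` with a common neighbour outside `U` are
adjacent, and that any two adjacent ones have a common neighbour outside `U`. Choosing such a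
neighbour `i u` for each `u ∈ U \ {r}` and its parent `p u` (which lies in `U`), the edges
`{u, i u}` are distinct and lie outside the breadth-first tree rooted at `r ∈ U`. -/
theorem card_le_cyclomaticNumber_add_one [Finite V] (hG : G.Connected) {U : Finset V}
    (hU : G.IsVertexCover U) {r : V} (hr : r ∈ U)
    (hadj : ∀ u ∈ U, ∀ v ∈ U, u ≠ v → ∀ i ∉ U, G.Adj u i → G.Adj v i → G.Adj u v)
    (hcommon : ∀ u ∈ U, ∀ v ∈ U, G.Adj u v → ∃ i ∉ U, G.Adj u i ∧ G.Adj v i) :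
    (#U : ℤ) ≤ cyclomaticNumber G + 1 := by
  classical
  obtain ⟨p, hp⟩ := exists_parent hG r
  have hpU : ∀ u ∈ U, u ≠ r → p u ∈ U := fun u hu hur =>
    parent_mem_of_isVertexCover hG hU hr hp hadj hu hur
  have : ∀ u, ∃ i, u ∈ U → u ≠ r → i ∉ U ∧ G.Adj u i ∧ G.Adj (p u) i := by
    intro u
    by_cases h : u ∈ U ∧ u ≠ r
    · obtain ⟨i, hi⟩ := hcommon u h.1 (p u) (hpU u h.1 h.2) (hp u h.2).1
      exact ⟨i, fun _ _ => hi⟩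
    · exact ⟨u, fun h1 h2 => absurd ⟨h1, h2⟩ h⟩
  choose i hi using this
  have hle : ((U.erase r : Finset V) : Set V).ncard ≤
      (G.edgeSet \ parentEdges p r).ncard := by
    refine Set.ncard_le_ncard_of_injOn (fun u => s(u, i u)) ?_ ?_
    · intro u hu
      obtain ⟨hur, huU⟩ := mem_erase.1 hu
      obtain ⟨hiU, h1, h2⟩ := hi u huU hur
      refine ⟨h1, ?_⟩
      rintro ⟨v, hv, hve⟩
      rcases Sym2.eq_iff.1 hve with ⟨rfl, h⟩ | ⟨rfl, h⟩
      · exact hiU (h ▸ hpU v huU hur)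
      · -- `p u` would be a neighbour of `i u` two levels above it
        have h3 := (hp (i u) hv).2
        have h4 := (hp u hur).2
        have h5 := dist_le_dist_add_one hG h2.symm r
        rw [h] at h3
        omega
    · intro u hu v hv h
      obtain ⟨hur, huU⟩ := mem_erase.1 hu
      obtain ⟨hvr, hvU⟩ := mem_erase.1 hv
      rcases Sym2.eq_iff.1 h with h | ⟨h, -⟩
      · exact h.1
      · exact absurd (h ▸ huU) (hi v hvU hvr).1
  rw [Set.ncard_coe_finset, card_erase_of_mem hr] at hle
  have := card_pos.2 ⟨r, hr⟩
  rw [cyclomaticNumber_eq hG hp]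
  omega

end Tree

/-! ### Eigenvectors and vertex covers -/

section Eigen

variable {V : Type*} [Fintype V] [DecidableEq V] {G : SimpleGraph V} [DecidableRel G.Adj] {lam : ℝ}

theorem mem_eigenspace_adjMatrix {x : V → ℝ} :
    x ∈ Module.End.eigenspace (Matrix.toLin' (G.adjMatrix ℝ)) lam ↔
      ∀ v, ∑ w ∈ G.neighborFinset v, x w = lam * x v := by
  simp [funext_iff, adjMatrix_mulVec_apply]

/-- The restriction of eigenvectors of the adjacency matrix to a set of vertices. -/
def eigenRestrict (G : SimpleGraph V) [DecidableRel G.Adj] (lam : ℝ) (U : Finset V) :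
    Module.End.eigenspace (Matrix.toLin' (G.adjMatrix ℝ)) lam →ₗ[ℝ] (U → ℝ) :=
  LinearMap.funLeft ℝ ℝ (Subtype.val : U → V) ∘ₗ Submodule.subtype _

/-- For `lam ≠ 0` an eigenvector is determined by its values on a vertex cover: the neighbours
of any other vertex lie in the cover. -/
theorem eigenRestrict_injective {U : Finset V} (hU : G.IsVertexCover U) (hlam : lam ≠ 0) :
    Function.Injective (eigenRestrict G lam U) := by
  rw [← LinearMap.ker_eq_bot, LinearMap.ker_eq_bot']
  rintro ⟨x, hx⟩ h
  have hxU : ∀ v ∈ U, x v = 0 := fun v hv => congrFun h ⟨v, hv⟩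
  ext v
  by_cases hv : v ∈ U
  · exact hxU v hv
  · have h1 := mem_eigenspace_adjMatrix.1 hx v
    rw [Finset.sum_eq_zero] at h1
    · simpa [hlam] using h1.symm
    · intro w hw
      exact hxU w ((hU ((mem_neighborFinset _ _ _).1 hw)).resolve_left hv)

theorem eigMult_le_card {U : Finset V} (hU : G.IsVertexCover U) (hlam : lam ≠ 0) :
    eigMult G lam ≤ #U := by
  have := LinearMap.finrank_le_finrank_of_injective (eigenRestrict_injective hU hlam)
  rwa [Module.finrank_fintype_fun_eq_card, Fintype.card_coe] at this

/-- If the multiplicity of `lam ≠ 0` is the size of a vertex cover `U`, every vector on `U` extends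
to an eigenvector. Extending the unit vector at `v` and reading the eigenvalue equation at `u`
yields the matrix equation `lam² = lam * A_U + B * Bᵀ`, where `A_U` is the adjacency matrix of the
graph induced on `U` and `B` is the biadjacency matrix between `U` and its complement. -/
theorem card_common_of_eigMult_eq {U : Finset V} (hU : G.IsVertexCover U) (hlam : lam ≠ 0)
    (hcard : eigMult G lam = #U) {u v : V} (hu : u ∈ U) (hv : v ∈ U) :
    (if G.Adj u v then lam else 0) + #{i | i ∉ U ∧ G.Adj u i ∧ G.Adj v i} =
      if u = v then lam ^ 2 else 0 := by
  have hsurj : Function.Surjective (eigenRestrict G lam U) := by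
    refine (LinearMap.injective_iff_surjective_of_finrank_eq_finrank ?_).1
      (eigenRestrict_injective hU hlam)
    rw [Module.finrank_fintype_fun_eq_card, Fintype.card_coe]
    exact hcard
  obtain ⟨⟨x, hx⟩, hxv⟩ := hsurj (Pi.single ⟨v, hv⟩ 1)
  have hxU : ∀ w ∈ U, x w = if w = v then 1 else 0 := by
    intro w hw
    have h : x w = _ := congrFun hxv ⟨w, hw⟩
    rw [h, Pi.single_apply]
    simp [Subtype.ext_iff]
  rw [mem_eigenspace_adjMatrix] at hx
  have hxI : ∀ i ∉ U, lam * x i = if G.Adj v i then 1 else 0 := by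
    intro i hi
    rw [← hx i, Finset.sum_congr rfl fun w hw => hxU w
      ((hU ((mem_neighborFinset _ _ _).1 hw)).resolve_left hi)]
    simp [G.adj_comm]
  have h1 := congrArg (lam * ·) (hx u)
  simp only [Finset.mul_sum] at h1
  have h2 : ∀ w ∈ G.neighborFinset u, lam * x w =
      (if w = v then lam else 0) + if w ∉ U ∧ G.Adj v w then 1 else 0 := by
    intro w _
    by_cases hw : w ∈ U
    · simp [hxU w hw, hw]
    · have : w ≠ v := fun h => hw (h ▸ hv)
      simp [hxI w hw, hw, this]
  rw [Finset.sum_congr rfl h2, sum_add_distrib, hxU u hu, Finset.sum_ite_eq'] at h1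
  have h3 : (G.neighborFinset u).filter (fun w => w ∉ U ∧ G.Adj v w) =
      ({i | i ∉ U ∧ G.Adj u i ∧ G.Adj v i} : Finset V) := by
    ext i
    simp
    tauto
  rw [card_eq_sum_ones, ← h3, sum_filter]
  simpa [pow_two] using h1

end Eigen

/-! ### Stars and the triangle -/

section Families

variable {V : Type*} {G : SimpleGraph V}

theorem isStar_iff [Finite V] : IsStar G ↔ Nontrivial V ∧ ∃ r, G = starGraph r := by
  constructor
  · rintro ⟨t, ht, ⟨e⟩⟩
    have : Nontrivial V :=
      ⟨e.symm (.inl 0), e.symm (.inr ⟨0, ht⟩), by simp⟩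
    refine ⟨this, e.symm (.inl 0), ?_⟩
    ext v w
    rw [← e.map_adj_iff, starGraph_adj, ← e.injective.ne_iff, ← e.injective.eq_iff (a := v),
      ← e.injective.eq_iff (a := w)]
    rcases e v with a | a <;> rcases e w with b | b <;> simp [Fin.fin_one_eq_zero]
  · rintro ⟨_, r, rfl⟩
    classical
    have := Fintype.ofFinite V
    obtain ⟨v, hv⟩ := exists_ne r
    refine ⟨Fintype.card {v // ¬ v = r}, Fintype.card_pos_iff.2 ⟨⟨v, hv⟩⟩, ⟨?_⟩⟩
    let e1 : {v // v = r} ≃ Fin 1 := Equiv.ofUnique _ _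
    let e2 := Fintype.equivFin {v // ¬ v = r}
    refine ⟨(Equiv.sumCompl (· = r)).symm.trans (Equiv.sumCongr e1 e2), ?_⟩
    intro v w
    by_cases hv : v = r <;> by_cases hw : w = r <;>
      simp [hv, hw, Equiv.sumCompl_symm_apply_of_pos, Equiv.sumCompl_symm_apply_of_neg,
        completeBipartiteGraph, eq_comm (a := r)]

theorem isStar_of_isVertexCover_singleton [Finite V] [Nontrivial V]
    (hG : G.Connected) {u : V} (hu : G.IsVertexCover ({u} : Finset V)) : IsStar G := by
  refine isStar_iff.2 ⟨inferInstance, u, ?_⟩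
  have h : ∀ v w, G.Adj v w → v = u ∨ w = u := fun v w h => by simpa using hu h
  have h' : ∀ v, v ≠ u → G.Adj u v := by
    intro v hv
    obtain ⟨w, hw⟩ := hG.preconnected.exists_adj_of_nontrivial v
    rcases h v w hw with rfl | rfl
    · exact absurd rfl hv
    · exact hw.symm
  ext v w
  rw [starGraph_adj]
  refine ⟨fun hvw => ⟨hvw.ne, h v w hvw⟩, ?_⟩
  rintro ⟨hne, rfl | rfl⟩
  · exact h' w hne.symm
  · exact (h' v hne).symm

theorem isC3_iff : IsC3 G ↔ G = ⊤ ∧ Nat.card V = 3 := by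
  rw [IsC3, cycleGraph_three_eq_top]
  constructor
  · rintro ⟨e⟩
    refine ⟨?_, by simpa using Nat.card_congr e.toEquiv⟩
    ext v w
    rw [← e.map_adj_iff, top_adj, top_adj, e.injective.ne_iff]
  · rintro ⟨rfl, h⟩
    have : Finite V := Nat.finite_of_card_ne_zero (by omega)
    exact ⟨Iso.completeGraph (Finite.equivFinOfCardEq h)⟩

theorem matchingNumber_add_cyclomaticNumber_le_of_isStar [Finite V] (h : IsStar G) :
    matchingNumber G + cyclomaticNumber G ≤ 1 := by
  classical
  have := Fintype.ofFinite V
  obtain ⟨-, r, rfl⟩ := isStar_iff.1 h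
  have hT := isTree_starGraph r
  have h1 : matchingNumber (starGraph r) ≤ 1 := by
    apply matchingNumber_le_one
    simp only [starGraph_adj]
    grind
  have h2 : (starGraph r).edgeSet.ncard + 1 = Nat.card V := by
    rw [Set.ncard_eq_toFinset_card', Nat.card_eq_fintype_card, ← hT.card_edgeFinset]
    rfl
  have h3 := card_connectedComponent_of_connected hT.1
  rw [cyclomaticNumber]
  omega

theorem matchingNumber_add_cyclomaticNumber_le_of_isC3 [Finite V] (h : IsC3 G) :
    matchingNumber G + cyclomaticNumber G ≤ 2 := by
  classical
  have := Fintype.ofFinite V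
  obtain ⟨rfl, hV⟩ := isC3_iff.1 h
  have : Nonempty V := (Nat.card_pos_iff.1 (by omega)).1
  have h1 : matchingNumber (⊤ : SimpleGraph V) ≤ 1 := by
    apply matchingNumber_le_one
    intro a b c d hab hcd
    rw [top_adj] at hab hcd
    by_contra! hne
    have h4 : #{a, b, c, d} = 4 := by simp [hab, hcd, hne]
    have h5 : #{a, b, c, d} ≤ Fintype.card V := card_le_univ _
    rw [← Nat.card_eq_fintype_card] at h5
    omega
  have h2 : (⊤ : SimpleGraph V).edgeSet.ncard = 3 := by
    rw [Set.ncard_eq_toFinset_card']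
    have := card_edgeFinset_top_eq_card_choose_two (V := V)
    rw [← Nat.card_eq_fintype_card, hV] at this
    exact this
  have h3 : Nat.card (⊤ : SimpleGraph V).ConnectedComponent = 1 :=
    card_connectedComponent_of_connected connected_top
  rw [cyclomaticNumber]
  omega

variable [Fintype V] [DecidableEq V] [DecidableRel G.Adj] {lam : ℝ}

/-- On a complete graph every vector with zero sum is an eigenvector for `-1`. -/
theorem two_le_eigMult_of_isC3 (h : IsC3 G) : 2 ≤ eigMult G (-1) := by
  obtain ⟨rfl, hV⟩ := isC3_iff.1 h
  let f : (V → ℝ) →ₗ[ℝ] ℝ := ∑ v, LinearMap.proj v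
  have h1 := f.finrank_range_add_finrank_ker
  have h2 : Module.finrank ℝ f.range ≤ 1 := by
    simpa using Submodule.finrank_le f.range
  rw [Module.finrank_fintype_fun_eq_card, ← Nat.card_eq_fintype_card, hV] at h1
  have h3 : f.ker ≤ Module.End.eigenspace
      (Matrix.toLin' ((⊤ : SimpleGraph V).adjMatrix ℝ)) (-1) := by
    intro x hx
    have hx : ∑ v, x v = 0 := by simpa [f] using hx
    rw [mem_eigenspace_adjMatrix]
    intro v
    rw [← Finset.add_sum_erase _ _ (mem_univ v)] at hx
    have : (⊤ : SimpleGraph V).neighborFinset v = univ.erase v := by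
      ext w
      simp [eq_comm]
    rw [this]
    linarith
  have := Submodule.finrank_mono h3
  rw [eigMult]
  omega

theorem hasEigenvalue_iff_eigMult_pos :
    Module.End.HasEigenvalue (Matrix.toLin' (G.adjMatrix ℝ)) lam ↔ 0 < eigMult G lam := by
  rw [eigMult, Module.finrank_pos_iff, Submodule.nontrivial_iff_ne_bot]
  rfl

/-- The star `K_{1,t}` has the eigenvalue `√t`, with the value `√t` at the centre and `1` at the
leaves of the eigenvector. -/
theorem exists_hasEigenvalue_of_isStar (h : IsStar G) :
    ∃ lam : ℝ, lam ≠ 0 ∧ Module.End.HasEigenvalue (Matrix.toLin' (G.adjMatrix ℝ)) lam := by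
  obtain ⟨_, r, rfl⟩ := isStar_iff.1 h
  have hcard : (0 : ℝ) < #(univ.erase r) := by
    obtain ⟨v, hv⟩ := exists_ne r
    exact_mod_cast card_pos.2 ⟨v, by simpa using hv⟩
  have hne := (Real.sqrt_pos.2 hcard).ne'
  refine ⟨√(#(univ.erase r) : ℝ), hne, ?_⟩
  refine Module.End.hasEigenvalue_of_hasEigenvector
    (x := fun v => if v = r then √(#(univ.erase r) : ℝ) else 1) ⟨?_, ?_⟩
  · rw [mem_eigenspace_adjMatrix]
    intro v
    by_cases hv : v = r
    · subst hv
      have : (starGraph v).neighborFinset v = univ.erase v := by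
        ext w
        simp [eq_comm]
      rw [this, if_pos rfl, Real.mul_self_sqrt hcard.le, Finset.sum_congr rfl
        fun w hw => if_neg (ne_of_mem_erase hw)]
      simp
    · have : (starGraph r).neighborFinset v = {r} := by
        ext w
        simp [hv]
        grind
      rw [this]
      simp [hv]
  · intro h0
    have := congrFun h0 r
    simp only [if_pos] at this
    exact hne this

end Families

/-! ### The equality case -/

section Equality

variable {V : Type*} [Fintype V] [DecidableEq V] {G : SimpleGraph V} [DecidableRel G.Adj] {lam : ℝ}

/-- If the multiplicity attains the bound, it is the size of a vertex cover `U`, and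
`card_common_of_eigMult_eq` applies. Either `U` is a single vertex and `G` is a star, or
`card_le_cyclomaticNumber_add_one` leaves no room for two disjoint edges and `G` is a triangle
consisting of two adjacent vertices of `U` and their common neighbour. -/
theorem isC3_or_isStar_of_eigMult_eq (hG : G.Connected) (hlam : lam ≠ 0)
    (hpos : 0 < eigMult G lam)
    (heq : (eigMult G lam : ℤ) = matchingNumber G + cyclomaticNumber G) :
    (IsC3 G ∧ lam = -1) ∨ IsStar G := by
  obtain ⟨U, hU, hUle⟩ := exists_isVertexCover_card_le hG
  have hcard : eigMult G lam = #U := by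
    have := eigMult_le_card hU hlam
    omega
  have key := fun {u v : V} => card_common_of_eigMult_eq (u := u) (v := v) hU hlam hcard
  obtain ⟨r, hr⟩ := card_pos.1 (hcard ▸ hpos)
  have hcommon : ∀ u ∈ U, ∀ v ∈ U, G.Adj u v → ∃ i ∉ U, G.Adj u i ∧ G.Adj v i := by
    intro u hu v hv huv
    have h1 := key hu hv
    rw [if_pos huv, if_neg huv.ne] at h1
    have h2 : #{i | i ∉ U ∧ G.Adj u i ∧ G.Adj v i} ≠ 0 := by
      intro h0
      rw [h0] at h1
      exact hlam (by simpa using h1)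
    obtain ⟨i, hi⟩ := card_ne_zero.1 h2
    exact ⟨i, by simpa using hi⟩
  have hadj : ∀ u ∈ U, ∀ v ∈ U, u ≠ v → ∀ i ∉ U, G.Adj u i → G.Adj v i → G.Adj u v := by
    intro u hu v hv huv i hi hui hvi
    by_contra hn
    have h1 := key hu hv
    rw [if_neg hn, if_neg huv, zero_add, Nat.cast_eq_zero, card_eq_zero] at h1
    have : i ∈ ({i | i ∉ U ∧ G.Adj u i ∧ G.Adj v i} : Finset V) := by simp [hi, hui, hvi]
    rw [h1] at this
    exact notMem_empty _ this
  by_cases hU1 : #U = 1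
  · right
    obtain ⟨u, rfl⟩ := card_eq_one.1 hU1
    -- `lam² ≠ 0` is the number of neighbours of `u` outside the cover
    have h1 := key (mem_singleton_self u) (mem_singleton_self u)
    have h2 : #{i | i ∉ ({u} : Finset V) ∧ G.Adj u i ∧ G.Adj u i} ≠ 0 := by
      intro h0
      rw [h0] at h1
      exact pow_ne_zero 2 hlam (by simpa using h1.symm)
    obtain ⟨i, hi⟩ := card_ne_zero.1 h2
    have : Nontrivial V := ⟨u, i, (mem_filter.1 hi).2.2.1.ne⟩
    exact isStar_of_isVertexCover_singleton hG hU
  · left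
    have hUc := card_le_cyclomaticNumber_add_one hG hU hr hadj hcommon
    -- `β + c = #U ≤ c + 1`
    have hβ : matchingNumber G ≤ 1 := by omega
    obtain ⟨a, b, ha, hb, hab⟩ : ∃ a b, a ∈ U ∧ b ∈ U ∧ G.Adj a b := by
      obtain ⟨a, ha, har⟩ := exists_mem_ne (s := U) (by have := card_pos.2 ⟨r, hr⟩; omega) r
      obtain ⟨p, hp⟩ := exists_parent hG r
      exact ⟨a, p a, ha, parent_mem_of_isVertexCover hG hU hr hp hadj ha har, (hp a har).1⟩
    obtain ⟨i, hi, hai, hbi⟩ := hcommon a ha b hb hab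
    have htri := eq_of_triangle hG hβ hab hbi hai
    have hI : ({j | j ∉ U ∧ G.Adj a j ∧ G.Adj b j} : Finset V) = {i} := by
      ext j
      rw [mem_filter, mem_singleton]
      constructor
      · rintro ⟨-, hj, -⟩
        rcases htri j with rfl | rfl | rfl
        · exact absurd ha hj
        · exact absurd hb hj
        · rfl
      · rintro rfl
        exact ⟨mem_univ _, hi, hai, hbi⟩
    refine ⟨isC3_iff.2 ⟨?_, ?_⟩, ?_⟩
    · ext v w
      rw [top_adj]
      refine ⟨Adj.ne, fun hvw => ?_⟩
      rcases htri v with rfl | rfl | rfl <;> rcases htri w with rfl | rfl | rfl <;>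
        first | exact absurd rfl hvw | assumption | (apply Adj.symm; assumption)
    · have : (univ : Finset V) = {a, b, i} := by
        ext v
        simpa using htri v
      rw [Nat.card_eq_fintype_card, ← card_univ, this]
      exact card_eq_three.2 ⟨a, b, i, hab.ne, hai.ne, hbi.ne, rfl⟩
    · have h1 := key ha hb
      rw [if_pos hab, if_neg hab.ne, hI, card_singleton] at h1
      push_cast at h1
      linarith

end Equality
end EigMatching

theorem lemma3p6 {V : Type*} [Fintype V] [DecidableEq V] (G : SimpleGraph V)
    [DecidableRel G.Adj] (hG : G.Connected) :
    (∀ lam : ℝ, lam ≠ 0 →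
      Module.End.HasEigenvalue (Matrix.toLin' (G.adjMatrix ℝ)) lam →
        (EigMatching.eigMult G lam : ℤ) ≤
            EigMatching.matchingNumber G + EigMatching.cyclomaticNumber G ∧
          ((EigMatching.eigMult G lam : ℤ) =
              EigMatching.matchingNumber G + EigMatching.cyclomaticNumber G ↔
            (EigMatching.IsC3 G ∧ lam = -1) ∨ EigMatching.IsStar G)) ∧
    ((∃ lam : ℝ, lam ≠ 0 ∧
        Module.End.HasEigenvalue (Matrix.toLin' (G.adjMatrix ℝ)) lam ∧
        (EigMatching.eigMult G lam : ℤ) =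
          EigMatching.matchingNumber G + EigMatching.cyclomaticNumber G) ↔
      EigMatching.IsC3 G ∨ EigMatching.IsStar G) := by
  open EigMatching in
  have hle : ∀ lam : ℝ, lam ≠ 0 →
      (eigMult G lam : ℤ) ≤ matchingNumber G + cyclomaticNumber G := by
    intro lam hlam
    obtain ⟨U, hU, hUle⟩ := exists_isVertexCover_card_le hG
    have := eigMult_le_card hU hlam
    omega
  have hstar : ∀ lam : ℝ, lam ≠ 0 → 0 < eigMult G lam → IsStar G →
      (eigMult G lam : ℤ) = matchingNumber G + cyclomaticNumber G := by
    intro lam hlam hpos h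
    have := matchingNumber_add_cyclomaticNumber_le_of_isStar h
    have := hle lam hlam
    omega
  have hC3 : IsC3 G → (eigMult G (-1) : ℤ) = matchingNumber G + cyclomaticNumber G := by
    intro h
    have := matchingNumber_add_cyclomaticNumber_le_of_isC3 h
    have := two_le_eigMult_of_isC3 h
    have := hle (-1) (by norm_num)
    omega
  refine ⟨fun lam hlam hev => ?_, ?_, ?_⟩
  · rw [hasEigenvalue_iff_eigMult_pos] at hev
    refine ⟨hle lam hlam, isC3_or_isStar_of_eigMult_eq hG hlam hev, ?_⟩
    rintro (⟨h, rfl⟩ | h)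
    · exact hC3 h
    · exact hstar lam hlam hev h
  · rintro ⟨lam, hlam, hev, heq⟩
    rw [hasEigenvalue_iff_eigMult_pos] at hev
    exact (isC3_or_isStar_of_eigMult_eq hG hlam hev heq).imp_left And.left
  · rintro (h | h)
    · refine ⟨-1, by norm_num, hasEigenvalue_iff_eigMult_pos.2 ?_, hC3 h⟩
      have := two_le_eigMult_of_isC3 h
      omega
    · obtain ⟨lam, hlam, hev⟩ := exists_hasEigenvalue_of_isStar h
      exact ⟨lam, hlam, hev, hstar lam hlam (hasEigenvalue_iff_eigMult_pos.1 hev) h⟩
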